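/- Let $V$ be a real vector space, $C\subseteq V$ a cone ($C$ is convex, $\lambda C\subseteq C$ for $\lambda\ge 0$, $C\cap -C=\{0\}$), and write $v\le w$ if $w-v\in C$. An element $u\in C$ is an *order unit* if for every $v\in V$ there is $\lambda\ge 0$ with $-\lambda u\le v\le\lambda u$. $(V,C,u)$ is an *order unit space* if $u$ is an order unit and $C$ is Archimedean (for $v\in V$, $w\in C$: $nv\le w$ for all $n\in\mathbb N$ implies $v\le 0$). It carries the norm $\|v\|_u=\inf\{\lambda\ge 0: -\lambda u\le v\le\lambda u\}$; $C^\circ$ is the interior of $C$ for this norm, and $V$ is *reflexive* if it is reflexive for this norm. For $v\in V$ and an order unit $w$ put $M(v/w)=\inf\{\mu\in\mathbb R: v\le\mu w\}$. If $(W,K,e)$ is a second order unit space, a map $\Psi\colon C^\circ\to K^\circ$ is *gauge-reversing* if it is bijective and $M(v/w)=M(\Psi(w)/\Psi(v))$ for all $v,w\in C^\circ$. A non-zero $r\in C$ is an *extreme vector* if $0\le v\le r$ implies $v=\lambda r$ for some $\lambda\ge 0$. For an order unit $v$, an *atom relative to $v$* is an extreme vector $p$ of $C$ with $M(p/v)=1$;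 finitely many atoms $p_1,\dots,p_n$ relative to $v$ are *orthogonal* (relative to $v$) if $p_1+\dots+p_n\le v$. The *atoms of $C$* are the atoms relative to $u$. **Theorem.** Let $(V,C,u)$ and $(W,K,e)$ be order unit spaces such that $V$ is reflexive, and suppose that there is a gauge-reversing map $\Psi\colon C^\circ\to K^\circ$. Then: 1. for every order unit $v$ of $(V,C)$ there are finitely many orthogonal atoms $p_1,\dots,p_n$ relative to $v$ with $p_1+\dots+p_n=v$; 2. $C^\circ$ is contained in the positive span of the atoms of $C$, i.e. every element of $C^\circ$ is a finite linear combination of atoms of $C$ with nonnegative coefficients; 3. $V$ is the linear span of the atoms of $C$. (In the case $V=\{0\}$ the empty sum is allowed.) -/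

import Mathlib

namespace OrderUnit

variable {V : Type*} [AddCommGroup V] [Module ℝ V]

/-- The order `v ≤ w` induced by a cone `C`, i.e. `w - v ∈ C`. -/
def Le (C : PointedCone ℝ V) (v w : V) : Prop := w - v ∈ C

/-- `u` is an order unit for the cone `C`. -/
def IsOrderUnit (C : PointedCone ℝ V) (u : V) : Prop :=
  u ∈ C ∧ ∀ v : V, ∃ t : ℝ, 0 ≤ t ∧ Le C (-(t • u)) v ∧ Le C v (t • u)

/-- `(V, C, u)` is an order unit space: `C` is a cone (convex, closed under nonnegative scalars,
`C ∩ -C = {0}`), it is Archimedean, and `u` is an order unit. -/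
structure IsOrderUnitSpace (C : PointedCone ℝ V) (u : V) : Prop where
  salient : ∀ v : V, v ∈ C → -v ∈ C → v = 0
  archimedean : ∀ v w : V, w ∈ C → (∀ n : ℕ, Le C ((n : ℝ) • v) w) → Le C v 0
  isOrderUnit : IsOrderUnit C u

/-- The order unit norm `‖v‖_u = inf {t ≥ 0 : -t u ≤ v ≤ t u}`. -/
noncomputable def unitNorm (C : PointedCone ℝ V) (u v : V) : ℝ :=
  sInf {t : ℝ | 0 ≤ t ∧ Le C (-(t • u)) v ∧ Le C v (t • u)}

theorem smul_mem_cone {C : PointedCone ℝ V} {v : V} (hv : v ∈ C) {t : ℝ} (ht : 0 ≤ t) :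
    t • v ∈ C :=
  C.smul_mem ht hv

theorem unitNorm_bddBelow (C : PointedCone ℝ V) (u v : V) :
    BddBelow {t : ℝ | 0 ≤ t ∧ Le C (-(t • u)) v ∧ Le C v (t • u)} :=
  ⟨0, fun _ h => h.1⟩

theorem unitNorm_nonneg (C : PointedCone ℝ V) (u v : V) : 0 ≤ unitNorm C u v :=
  Real.sInf_nonneg fun _ h => h.1

theorem unitNorm_le {C : PointedCone ℝ V} {u v : V} {t : ℝ} (ht : 0 ≤ t)
    (h1 : Le C (-(t • u)) v) (h2 : Le C v (t • u)) : unitNorm C u v ≤ t :=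
  csInf_le (unitNorm_bddBelow C u v) ⟨ht, h1, h2⟩

/-- Every bound strictly larger than the norm is attained. -/
theorem IsOrderUnit.le_of_unitNorm_lt {C : PointedCone ℝ V} {u v : V} (h : IsOrderUnit C u)
    {t : ℝ} (ht : unitNorm C u v < t) : Le C (-(t • u)) v ∧ Le C v (t • u) := by
  obtain ⟨s, ⟨_, h1, h2⟩, hst⟩ := exists_lt_of_csInf_lt (h.2 v) ht
  have hd : (t - s) • u ∈ C := smul_mem_cone h.1 (by linarith)
  constructor
  · have := C.add_mem h1 hd
    rwa [show v - -(s • u) + (t - s) • u = v - -(t • u) by module] at this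
  · have := C.add_mem h2 hd
    rwa [show s • u - v + (t - s) • u = t • u - v by module] at this

theorem IsOrderUnit.unitNorm_add_le {C : PointedCone ℝ V} {u : V} (h : IsOrderUnit C u)
    (v w : V) : unitNorm C u (v + w) ≤ unitNorm C u v + unitNorm C u w := by
  refine le_of_forall_pos_le_add fun ε hε => ?_
  obtain ⟨a1, a2⟩ := h.le_of_unitNorm_lt (v := v) (t := unitNorm C u v + ε / 2) (by linarith)
  obtain ⟨b1, b2⟩ := h.le_of_unitNorm_lt (v := w) (t := unitNorm C u w + ε / 2) (by linarith)
  have hv := unitNorm_nonneg C u v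
  have hw := unitNorm_nonneg C u w
  have e : unitNorm C u v + unitNorm C u w + ε
      = (unitNorm C u v + ε / 2) + (unitNorm C u w + ε / 2) := by ring
  rw [e]
  refine unitNorm_le (by linarith) ?_ ?_
  · have := C.add_mem a1 b1
    unfold Le
    convert this using 1
    module
  · have := C.add_mem a2 b2
    unfold Le
    convert this using 1
    module

theorem unitNorm_zero {C : PointedCone ℝ V} {u : V} : unitNorm C u 0 = 0 :=
  le_antisymm (unitNorm_le le_rfl (by simp [Le]) (by simp [Le])) (unitNorm_nonneg C u 0)

theorem unitNorm_neg (C : PointedCone ℝ V) (u v : V) : unitNorm C u (-v) = unitNorm C u v := by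
  unfold unitNorm
  congr 1
  ext t
  have e1 : -v - -(t • u) = t • u - v := by abel
  have e2 : t • u - -v = v - -(t • u) := by abel
  simp only [Set.mem_ofPred_eq, Le, e1, e2]
  tauto

theorem IsOrderUnitSpace.eq_zero_of_unitNorm {C : PointedCone ℝ V} {u v : V}
    (h : IsOrderUnitSpace C u) (hv : unitNorm C u v = 0) : v = 0 := by
  have key : ∀ w : V, unitNorm C u w = 0 → Le C w 0 := by
    intro w hw
    refine h.archimedean w u h.isOrderUnit.1 fun n => ?_
    have hn : (0 : ℝ) < (n : ℝ) + 1 := by positivity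
    have h2 := (h.isOrderUnit.le_of_unitNorm_lt (v := w) (t := ((n : ℝ) + 1)⁻¹)
      (by rw [hw]; positivity)).2
    have h3 := smul_mem_cone h2 (t := (n : ℝ)) (by positivity)
    have h4 := smul_mem_cone h.isOrderUnit.1 (t := ((n : ℝ) + 1)⁻¹) (by positivity)
    have h5 := C.add_mem h3 h4
    unfold Le
    convert h5 using 1
    have e : (n : ℝ) * ((n : ℝ) + 1)⁻¹ + ((n : ℝ) + 1)⁻¹ = 1 := by field_simp
    calc u - (n : ℝ) • w = ((n : ℝ) * ((n : ℝ) + 1)⁻¹ + ((n : ℝ) + 1)⁻¹) • u - (n : ℝ) • w := by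
          rw [e, one_smul]
      _ = _ := by module
  have a := key v hv
  have b := key (-v) (by rw [unitNorm_neg, hv])
  simp only [Le, zero_sub, neg_neg] at a b
  exact h.salient v b a

theorem unitNorm_smul_le {C : PointedCone ℝ V} {u : V} (h : IsOrderUnit C u) (r : ℝ) (v : V) :
    unitNorm C u (r • v) ≤ |r| * unitNorm C u v := by
  have pos : ∀ s : ℝ, 0 ≤ s → unitNorm C u (s • v) ≤ s * unitNorm C u v := by
    intro s hs
    refine le_of_forall_pos_le_add fun ε hε => ?_
    have hs1 : 0 < s + 1 := by linarith
    have hN := unitNorm_nonneg C u v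
    obtain ⟨a1, a2⟩ := h.le_of_unitNorm_lt (v := v) (t := unitNorm C u v + ε / (s + 1))
      (by have : 0 < ε / (s + 1) := by positivity
          linarith)
    have hle : unitNorm C u (s • v) ≤ s * (unitNorm C u v + ε / (s + 1)) := by
      refine unitNorm_le (by positivity) ?_ ?_
      · have := smul_mem_cone a1 hs
        unfold Le
        convert this using 1
        module
      · have := smul_mem_cone a2 hs
        unfold Le
        convert this using 1
        module
    have : s * (ε / (s + 1)) ≤ ε := by
      rw [← mul_div_assoc, div_le_iff₀ hs1]
      nlinarith
    nlinarith
  rcases le_total 0 r with hr | hr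
  · rw [abs_of_nonneg hr]
    exact pos r hr
  · rw [abs_of_nonpos hr, ← unitNorm_neg, ← neg_smul]
    exact pos (-r) (by linarith)

/-- `V` as a normed group under the order unit norm. -/
noncomputable abbrev IsOrderUnitSpace.normedAddCommGroup {C : PointedCone ℝ V} {u : V}
    (h : IsOrderUnitSpace C u) : NormedAddCommGroup V :=
  AddGroupNorm.toNormedAddCommGroup
    { toFun := unitNorm C u
      map_zero' := unitNorm_zero
      add_le' := h.isOrderUnit.unitNorm_add_le
      neg' := unitNorm_neg C u
      eq_zero_of_map_eq_zero' := fun _ => h.eq_zero_of_unitNorm }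

/-- `V` as a real normed space under the order unit norm. -/
noncomputable abbrev IsOrderUnitSpace.normedSpace {C : PointedCone ℝ V} {u : V}
    (h : IsOrderUnitSpace C u) :
    letI := h.normedAddCommGroup
    NormedSpace ℝ V :=
  letI := h.normedAddCommGroup
  { norm_smul_le := unitNorm_smul_le h.isOrderUnit }

/-- The interior `C°` of the cone for the topology of the order unit norm. -/
def IsOrderUnitSpace.coneInterior {C : PointedCone ℝ V} {u : V}
    (h : IsOrderUnitSpace C u) : Set V :=
  letI := h.normedAddCommGroup
  interior (C : Set V)

/-- The order unit space is reflexive: for the order unit norm, the canonical map of `V` into its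
bidual is onto. -/
def IsOrderUnitSpace.IsReflexive {C : PointedCone ℝ V} {u : V}
    (h : IsOrderUnitSpace C u) : Prop :=
  letI := h.normedAddCommGroup
  letI := h.normedSpace
  Function.Surjective (NormedSpace.inclusionInDoubleDual ℝ V)

/-- The gauge `M(v/w) = inf {μ ∈ ℝ : v ≤ μ w}`. -/
noncomputable def orderGauge (C : PointedCone ℝ V) (v w : V) : ℝ :=
  sInf {μ : ℝ | Le C v (μ • w)}

/-- A bijection `Ψ : C° → K°` with `M(v/w) = M(Ψ(w)/Ψ(v))` for all `v, w ∈ C°`. -/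
def IsGaugeReversing {W : Type*} [AddCommGroup W] [Module ℝ W]
    {C : PointedCone ℝ V} {u : V} {K : PointedCone ℝ W} {e : W}
    (hV : IsOrderUnitSpace C u) (hW : IsOrderUnitSpace K e)
    (Ψ : hV.coneInterior → hW.coneInterior) : Prop :=
  Function.Bijective Ψ ∧
    ∀ v w : hV.coneInterior, orderGauge C (v : V) (w : V) = orderGauge K (Ψ w : W) (Ψ v : W)

/-- `r` is an extreme vector of `C`: it is a nonzero vector of `C` such that every `v` with
`0 ≤ v ≤ r` is a nonnegative multiple of `r`. -/
def IsExtremeVector (C : PointedCone ℝ V) (r : V) : Prop :=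
  r ∈ C ∧ r ≠ 0 ∧ ∀ v : V, Le C 0 v → Le C v r → ∃ t : ℝ, 0 ≤ t ∧ v = t • r

/-- The atoms of `C` relative to the order unit `u`: extreme vectors `p` with `M(p/u) = 1`. -/
def atoms (C : PointedCone ℝ V) (u : V) : Set V :=
  {p | IsExtremeVector C p ∧ orderGauge C p u = 1}

/-- `p 0, …, p (n - 1)` are orthogonal atoms relative to `u`: atoms whose sum is at most `u`. -/
def AreOrthogonalAtoms (C : PointedCone ℝ V) (u : V) {n : ℕ} (p : Fin n → V) : Prop :=
  (∀ i, p i ∈ atoms C u) ∧ Le C (∑ i, p i) u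

end OrderUnit

/-! Let `Φ` be the extension of `Ψ` by zero. On order units, x ≤ μy iff Φy ≤ μΦx for μ > 0, so a
gauge x ↦ M(r/x) can be read as a function of Φx. It is linear there when it comes from a pure
functional φ, one spanning an extreme ray of the dual cone of `K`. The half-space φ < 1 is upward
directed, so the order units with φ(Φx) < 1 are downward directed. Reflexivity of V gives them an
infimum r, approached in norm, and M(r/x) = φ(Φx) (`IsPure.exists_represents`). Purity of φ makes r
extreme (`Represents.isExtremeVector`).

Such vectors are plentiful: if w ∈ C and M(w/u) = 1, the states of (W, K, Φu) bounded by M(w/·) form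
a nonempty compact face of the state space. An extreme point of it is pure, and its representing
vector is an atom below w (`exists_isPureAtom_le`).

Atoms are then split off u greedily. A partial sum s ≠ u of these atoms is never an order unit
(`sum_eq_of_isOrderUnit`), so M((u-s)/u) = 1 and another atom fits below u - s. An endless process
would have remainders converging in norm, forcing an atom of gauge one below u/2. Any order unit can
replace u; rescaling atoms and writing vectors as differences of order units gives the remaining
claims. -/

namespace OrderUnit

/-! ### Order, gauges and order units. -/

section Order

variable {V : Type*} [AddCommGroup V] [Module ℝ V] {C : PointedCone ℝ V} {u v w x y z : V}

theorem Le.trans (h₁ : Le C x y) (h₂ : Le C y z) : Le C x z := by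
  have := C.add_mem h₁ h₂
  rwa [show y - x + (z - y) = z - x by abel] at this

theorem Le.add (h₁ : Le C x y) (h₂ : Le C v w) : Le C (x + v) (y + w) := by
  have := C.add_mem h₁ h₂
  rwa [show y - x + (w - v) = y + w - (x + v) by abel] at this

theorem Le.smul (h : Le C x y) {t : ℝ} (ht : 0 ≤ t) : Le C (t • x) (t • y) := by
  have := smul_mem_cone h ht
  rwa [smul_sub] at this

theorem Le.refl (C : PointedCone ℝ V) (x : V) : Le C x x := by simp [Le]

theorem le_add_of_mem (x : V) (hy : y ∈ C) : Le C x (x + y) := by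
  simpa [Le] using hy

theorem le_of_zero_le (h : x ∈ C) : Le C 0 x := by simpa [Le] using h

theorem Le.mem (hx : x ∈ C) (h : Le C x y) : y ∈ C := by
  simpa using C.add_mem hx h

theorem smul_le_smul_of_mem (hx : x ∈ C) {s t : ℝ} (h : s ≤ t) : Le C (s • x) (t • x) := by
  have := smul_mem_cone hx (sub_nonneg.2 h)
  rwa [sub_smul] at this

theorem Le.of_smul {t : ℝ} (ht : 0 < t) (h : Le C (t • x) y) : Le C x (t⁻¹ • y) := by
  have := h.smul (inv_pos.2 ht).le
  rwa [smul_smul, inv_mul_cancel₀ ht.ne', one_smul] at this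

theorem Le.of_le_smul {t : ℝ} (ht : 0 < t) (h : Le C x (t • y)) : Le C (t⁻¹ • x) y := by
  have := h.smul (inv_pos.2 ht).le
  rwa [smul_smul, inv_mul_cancel₀ ht.ne', one_smul] at this

theorem IsOrderUnit.exists_le (h : IsOrderUnit C u) (v : V) : ∃ t : ℝ, 0 < t ∧ Le C v (t • u) := by
  obtain ⟨t, ht, -, h2⟩ := h.2 v
  exact ⟨t + 1, by linarith, h2.trans (smul_le_smul_of_mem h.1 (by linarith))⟩

theorem isOrderUnit_of_forall_exists_le (hu : u ∈ C) (h : ∀ v : V, ∃ t : ℝ, 0 ≤ t ∧ Le C v (t • u)) :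
    IsOrderUnit C u := by
  refine ⟨hu, fun v => ?_⟩
  obtain ⟨s, hs, h1⟩ := h v
  obtain ⟨t, ht, h2⟩ := h (-v)
  refine ⟨s + t, by linarith, ?_, h1.trans (smul_le_smul_of_mem hu (by linarith))⟩
  have h3 := h2.trans (smul_le_smul_of_mem hu (show t ≤ s + t by linarith))
  unfold Le at h3 ⊢
  rwa [show v - -((s + t) • u) = (s + t) • u - -v by abel]

theorem IsOrderUnit.of_le (h : IsOrderUnit C u) {t : ℝ} (ht : 0 < t) (hx : Le C (t • u) x) :
    IsOrderUnit C x := by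
  refine isOrderUnit_of_forall_exists_le (hx.mem (smul_mem_cone h.1 ht.le)) fun v => ?_
  obtain ⟨s, hs, h1⟩ := h.exists_le v
  refine ⟨s * t⁻¹, by positivity, h1.trans ?_⟩
  have := (hx.of_smul ht).smul hs.le
  rwa [smul_smul] at this

theorem IsOrderUnit.smul (h : IsOrderUnit C u) {t : ℝ} (ht : 0 < t) : IsOrderUnit C (t • u) :=
  h.of_le ht (Le.refl C _)

theorem IsOrderUnit.add_mem (h : IsOrderUnit C u) (hx : x ∈ C) : IsOrderUnit C (u + x) :=
  h.of_le one_pos (by rw [one_smul]; exact le_add_of_mem u hx)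

theorem IsOrderUnit.mem_add_smul (h : IsOrderUnit C u) (hx : x ∈ C) {t : ℝ} (ht : 0 < t) :
    IsOrderUnit C (x + t • u) := by
  rw [add_comm]
  exact (h.smul ht).add_mem hx

theorem IsOrderUnitSpace.antisymm (h : IsOrderUnitSpace C u) (h₁ : Le C x y) (h₂ : Le C y x) :
    x = y := by
  have := h.salient (y - x) h₁ (by rw [neg_sub]; exact h₂)
  exact (sub_eq_zero.1 this).symm

/-- The Archimedean property as a limit ε → 0: taking ε = 1/n and v ≤ tu gives n(x - y) ≤ tu for
every n ≥ 1. -/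
theorem IsOrderUnitSpace.le_of_forall_le_add (h : IsOrderUnitSpace C u)
    (hxy : ∀ ε : ℝ, 0 < ε → Le C x (y + ε • v)) : Le C x y := by
  obtain ⟨t, ht, hv⟩ := h.isOrderUnit.exists_le v
  have key := h.archimedean (x - y) (t • u) (smul_mem_cone h.isOrderUnit.1 ht.le) fun n => ?_
  · simpa [Le] using key
  · rcases Nat.eq_zero_or_pos n with rfl | hn
    · simpa [Le] using smul_mem_cone h.isOrderUnit.1 ht.le
    · have hn' : (0 : ℝ) < n := by exact_mod_cast hn
      have h1 := (hxy (n : ℝ)⁻¹ (by positivity)).smul hn'.le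
      rw [smul_add, smul_smul, mul_inv_cancel₀ hn'.ne', one_smul] at h1
      have h2 := h1.trans ((Le.refl C _).add hv)
      unfold Le at h2 ⊢
      convert h2 using 1
      rw [smul_sub]
      abel

theorem IsOrderUnitSpace.le_smul_of_forall_lt (h : IsOrderUnitSpace C u) {μ : ℝ}
    (hxy : ∀ ν : ℝ, μ < ν → Le C x (ν • y)) : Le C x (μ • y) :=
  h.le_of_forall_le_add (v := y) fun ε hε => by
    rw [← add_smul]
    exact hxy _ (by linarith)

theorem IsOrderUnitSpace.of_isOrderUnit (h : IsOrderUnitSpace C u) (hv : IsOrderUnit C v) :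
    IsOrderUnitSpace C v :=
  ⟨h.salient, h.archimedean, hv⟩

theorem IsOrderUnitSpace.ne_zero [Nontrivial V] (h : IsOrderUnitSpace C u) : u ≠ 0 := by
  rintro rfl
  obtain ⟨v, hv⟩ := exists_ne (0 : V)
  obtain ⟨t, -, h1, h2⟩ := h.isOrderUnit.2 v
  simp only [smul_zero, neg_zero] at h1 h2
  exact hv (h.antisymm h2 h1)

theorem IsOrderUnitSpace.le_of_smul_le_smul [Nontrivial V] (h : IsOrderUnitSpace C u) {s t : ℝ}
    (hst : Le C (s • u) (t • u)) : s ≤ t := by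
  by_contra! hlt
  have h1 := smul_mem_cone hst (inv_pos.2 (sub_pos.2 hlt)).le
  have e : (s - t)⁻¹ • (t • u - s • u) = -u := by
    rw [← sub_smul, smul_smul, ← neg_sub s t, mul_neg, inv_mul_cancel₀ (sub_pos.2 hlt).ne', neg_smul,
      one_smul]
  rw [e] at h1
  exact h.ne_zero (h.salient u h.isOrderUnit.1 h1)

theorem IsOrderUnitSpace.bddBelow_gauge [Nontrivial V] (h : IsOrderUnitSpace C u) (v : V) :
    BddBelow {μ : ℝ | Le C v (μ • u)} := by
  obtain ⟨t, -, h1, -⟩ := h.isOrderUnit.2 v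
  refine ⟨-t, fun μ hμ => h.le_of_smul_le_smul ?_⟩
  rw [neg_smul]
  exact h1.trans hμ

theorem IsOrderUnitSpace.orderGauge_le [Nontrivial V] (h : IsOrderUnitSpace C u) {μ : ℝ}
    (hv : Le C v (μ • u)) : orderGauge C v u ≤ μ :=
  csInf_le (h.bddBelow_gauge v) hv

theorem IsOrderUnitSpace.le_orderGauge_smul (h : IsOrderUnitSpace C u) (v : V) :
    Le C v (orderGauge C v u • u) := by
  refine h.le_smul_of_forall_lt fun ν hν => ?_
  obtain ⟨t, -, ht⟩ := h.isOrderUnit.exists_le v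
  obtain ⟨s, hs, hsν⟩ := exists_lt_of_csInf_lt ⟨t, ht⟩ hν
  exact hs.trans (smul_le_smul_of_mem h.isOrderUnit.1 hsν.le)

theorem IsOrderUnitSpace.le_smul_iff [Nontrivial V] (h : IsOrderUnitSpace C u) {μ : ℝ} :
    Le C v (μ • u) ↔ orderGauge C v u ≤ μ :=
  ⟨h.orderGauge_le, fun hμ =>
    (h.le_orderGauge_smul v).trans (smul_le_smul_of_mem h.isOrderUnit.1 hμ)⟩

theorem IsOrderUnitSpace.orderGauge_nonneg [Nontrivial V] (h : IsOrderUnitSpace C u) (hv : v ∈ C) :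
    0 ≤ orderGauge C v u := by
  refine h.le_of_smul_le_smul ?_
  rw [zero_smul]
  exact (le_of_zero_le hv).trans (h.le_orderGauge_smul v)

theorem IsOrderUnitSpace.orderGauge_add_le [Nontrivial V] (h : IsOrderUnitSpace C u) (v w : V) :
    orderGauge C (v + w) u ≤ orderGauge C v u + orderGauge C w u := by
  refine h.orderGauge_le ?_
  rw [add_smul]
  exact (h.le_orderGauge_smul v).add (h.le_orderGauge_smul w)

theorem IsOrderUnitSpace.orderGauge_smul_le [Nontrivial V] (h : IsOrderUnitSpace C u) {c : ℝ}
    (hc : 0 ≤ c) (v : V) : orderGauge C (c • v) u ≤ c * orderGauge C v u := by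
  refine h.orderGauge_le ?_
  rw [mul_smul]
  exact (h.le_orderGauge_smul v).smul hc

theorem IsOrderUnitSpace.orderGauge_smul [Nontrivial V] (h : IsOrderUnitSpace C u) {c : ℝ}
    (hc : 0 < c) (v : V) : orderGauge C (c • v) u = c * orderGauge C v u := by
  refine le_antisymm (h.orderGauge_smul_le hc.le v) ?_
  have := h.orderGauge_smul_le (inv_pos.2 hc).le (c • v)
  rw [smul_smul, inv_mul_cancel₀ hc.ne', one_smul] at this
  rwa [inv_mul_eq_div, le_div_iff₀ hc, mul_comm] at this

theorem IsOrderUnitSpace.orderGauge_eq [Nontrivial V] (h : IsOrderUnitSpace C u) {μ : ℝ}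
    (hv : Le C v (μ • u)) (hmin : ∀ ν : ℝ, 0 < ν → Le C v (ν • u) → μ ≤ ν)
    (hvC : v ∈ C) : orderGauge C v u = μ := by
  refine le_antisymm (h.orderGauge_le hv) (le_of_forall_gt_imp_ge_of_dense fun ν hν => ?_)
  exact hmin ν ((h.orderGauge_nonneg hvC).trans_lt hν) (h.le_smul_iff.2 hν.le)

/-- Removes topology from the hypothesis on `Ψ`: a ball around x contains x - (δ/2)u, and conversely
u ≤ tx makes the ball of radius 1/t around x lie in the cone. -/
theorem IsOrderUnitSpace.mem_coneInterior_iff (h : IsOrderUnitSpace C u) :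
    x ∈ h.coneInterior ↔ IsOrderUnit C x := by
  let := h.normedAddCommGroup
  have hnorm : ∀ v : V, ‖v‖ = unitNorm C u v := fun _ => rfl
  change x ∈ interior (C : Set V) ↔ _
  rw [mem_interior_iff_mem_nhds, Metric.mem_nhds_iff]
  constructor
  · rintro ⟨δ, hδ, hb⟩
    have hx : x - (δ / 2) • u ∈ C := by
      refine hb ?_
      rw [Metric.mem_ball, dist_eq_norm, hnorm, sub_sub_cancel_left, unitNorm_neg]
      refine lt_of_le_of_lt (unitNorm_le (t := δ / 2) (by linarith) ?_ (Le.refl C _))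
        (by linarith)
      unfold Le
      rw [sub_neg_eq_add, ← add_smul]
      exact smul_mem_cone h.isOrderUnit.1 (by linarith)
    exact h.isOrderUnit.of_le (half_pos hδ) hx
  · intro hx
    obtain ⟨t, ht, hut⟩ := hx.exists_le u
    refine ⟨t⁻¹, inv_pos.2 ht, fun y hy => ?_⟩
    rw [Metric.mem_ball, dist_eq_norm, hnorm] at hy
    have h1 := (h.isOrderUnit.le_of_unitNorm_lt hy).1
    have h2 := C.add_mem h1 (hut.of_le_smul ht)
    change y ∈ C
    convert h2 using 1
    abel

end Order

/-! ### Reflexivity and directed infima. -/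

/-- Every nonempty downward directed subset of the cone has a lower bound in the cone which it
approaches in norm. -/
def HasDirectedInf {V : Type*} [AddCommGroup V] [Module ℝ V] (C : PointedCone ℝ V) (u : V) : Prop :=
  ∀ A : Set V, A.Nonempty → A ⊆ C → DirectedOn (fun a b => Le C b a) A →
    ∃ r ∈ C, (∀ a ∈ A, Le C r a) ∧ ∀ ε : ℝ, 0 < ε → ∃ a ∈ A, Le C a (r + ε • u)

theorem HasDirectedInf.of_isOrderUnit {V : Type*} [AddCommGroup V] [Module ℝ V]
    {C : PointedCone ℝ V} {u v : V} (h : HasDirectedInf C u) (hv : IsOrderUnit C v) :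
    HasDirectedInf C v := by
  intro A hA hAC hd
  obtain ⟨r, hr, hle, happ⟩ := h A hA hAC hd
  refine ⟨r, hr, hle, fun ε hε => ?_⟩
  obtain ⟨t, ht, hu⟩ := hv.exists_le u
  obtain ⟨a, ha, har⟩ := happ (ε * t⁻¹) (by positivity)
  refine ⟨a, ha, har.trans ((Le.refl C r).add ?_)⟩
  have := hu.smul (show 0 ≤ ε * t⁻¹ by positivity)
  rwa [smul_smul (ε * t⁻¹), mul_assoc, inv_mul_cancel₀ ht.ne', mul_one] at this

/-- In a reflexive space, every ultrafilter containing a bounded set has a point which is adherent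
to all of its convex members. -/
theorem exists_forall_convex_mem_closure {E : Type*} [NormedAddCommGroup E] [NormedSpace ℝ E]
    (hE : Function.Surjective (NormedSpace.inclusionInDoubleDual ℝ E)) (U : Ultrafilter E)
    {B : Set E} (hB : Bornology.IsBounded B) (hBU : B ∈ U) :
    ∃ r : E, ∀ S : Set E, Convex ℝ S → S ∈ U → r ∈ closure S := by
  have hc : IsCompact (closure (toWeakSpace ℝ E '' B)) := by
    refine NormedSpace.isCompact_closure_of_isBounded ℝ E _ ?_ ?_
    · rwa [Set.preimage_image_eq _ (toWeakSpace ℝ E).injective]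
    -- Reflexivity enters only here: every bidual element is an evaluation, so the weak-* compact
    -- closure in the bidual comes from points of E.
    · intro F _
      obtain ⟨r, hr⟩ := hE (StrongDual.toWeakDual.symm F)
      refine ⟨toWeakSpace ℝ E r, ?_⟩
      apply StrongDual.toWeakDual.symm.injective
      rw [← hr]
      rfl
  obtain ⟨r, -, hr⟩ := hc.ultrafilter_le_nhds (U.map (toWeakSpace ℝ E)) (by
    rw [Filter.le_principal_iff]
    exact Filter.mem_of_superset (Filter.image_mem_map hBU) subset_closure)
  refine ⟨(toWeakSpace ℝ E).symm r, fun S hS hSU => ?_⟩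
  have h1 : r ∈ closure (toWeakSpace ℝ E '' S) := by
    rw [mem_closure_iff_ultrafilter]
    exact ⟨_, Filter.image_mem_map hSU, hr⟩
  -- Mazur: for a convex set the weak and norm closures agree.
  rw [← hS.toWeakSpace_closure ℝ] at h1
  obtain ⟨s, hs, rfl⟩ := h1
  simpa using hs

/-- Take a weak limit r along an ultrafilter containing all lower sections of A. The cone, each {b ≤
a} and the upward closure of A are convex members of it, so r is in their norm closures; these give
r ∈ C, r ≤ a and the norm approximation respectively. -/
theorem IsOrderUnitSpace.hasDirectedInf {V : Type*} [AddCommGroup V] [Module ℝ V]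
    {C : PointedCone ℝ V} {u : V} (h : IsOrderUnitSpace C u) (hrefl : h.IsReflexive) :
    HasDirectedInf C u := by
  let := h.normedAddCommGroup
  let := h.normedSpace
  have hnorm : ∀ v : V, ‖v‖ = unitNorm C u v := fun _ => rfl
  intro A hA hAC hd
  obtain ⟨a₀, ha₀⟩ := hA
  have : Nonempty A := ⟨⟨a₀, ha₀⟩⟩
  let T : A → Set V := fun a => {b | b ∈ A ∧ Le C b a}
  have hne : (⨅ a : A, Filter.principal (T a)).NeBot := by
    refine Filter.iInf_neBot_of_directed ?_ fun a =>
      Filter.principal_neBot_iff.2 ⟨a, a.2, Le.refl C _⟩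
    intro a b
    obtain ⟨c, hc, hca, hcb⟩ := hd a a.2 b b.2
    refine ⟨⟨c, hc⟩, ?_, ?_⟩
    · exact Filter.principal_mono.2 fun d hd => ⟨hd.1, hd.2.trans hca⟩
    · exact Filter.principal_mono.2 fun d hd => ⟨hd.1, hd.2.trans hcb⟩
  let U : Ultrafilter V := Ultrafilter.of (⨅ a : A, Filter.principal (T a))
  have hU : ∀ a : A, T a ∈ U := fun a =>
    Ultrafilter.of_le _ (Filter.mem_iInf_of_mem a (Filter.mem_principal_self _))
  obtain ⟨t, ht, hat⟩ := h.isOrderUnit.exists_le a₀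
  have hbdd : Bornology.IsBounded (T ⟨a₀, ha₀⟩) := by
    refine isBounded_iff_forall_norm_le.2 ⟨t, fun b hb => ?_⟩
    rw [hnorm]
    refine unitNorm_le ht.le ?_ (hb.2.trans hat)
    unfold Le
    rw [sub_neg_eq_add]
    exact C.add_mem (hAC hb.1) (smul_mem_cone h.isOrderUnit.1 ht.le)
  obtain ⟨r, hr⟩ := exists_forall_convex_mem_closure hrefl U hbdd (hU _)
  have happ : ∀ S : Set V, Convex ℝ S → S ∈ U → ∀ ε : ℝ, 0 < ε →
      ∃ s ∈ S, Le C s (r + ε • u) ∧ Le C r (s + ε • u) := by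
    intro S hS hSU ε hε
    obtain ⟨s, hs, hrs⟩ := Metric.mem_closure_iff.1 (hr S hS hSU) ε hε
    rw [dist_eq_norm, hnorm] at hrs
    obtain ⟨h1, h2⟩ := h.isOrderUnit.le_of_unitNorm_lt hrs
    refine ⟨s, hs, ?_, ?_⟩
    · unfold Le at h1 ⊢
      convert h1 using 1
      abel
    · unfold Le at h2 ⊢
      convert h2 using 1
      abel
  refine ⟨r, ?_, fun a ha => ?_, fun ε hε => ?_⟩
  · have h0 : Le C 0 r := by
      refine h.le_of_forall_le_add (v := u) fun ε hε => ?_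
      obtain ⟨s, hs, h1, -⟩ := happ (C : Set V) C.toConvexCone.convex
        (Filter.mem_of_superset (hU ⟨a₀, ha₀⟩) fun b hb => hAC hb.1) ε hε
      exact (le_of_zero_le hs).trans h1
    simpa [Le] using h0
  · refine h.le_of_forall_le_add (v := u) fun ε hε => ?_
    have hconv : Convex ℝ {b | Le C b a} := by
      intro b hb c hc p q hp hq hpq
      have := (Le.smul hb hp).add (Le.smul hc hq)
      rwa [← add_smul, hpq, one_smul] at this
    obtain ⟨s, hs, -, h2⟩ := happ _ hconv
      (Filter.mem_of_superset (hU ⟨a, ha⟩) fun b hb => hb.2) ε hε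
    exact h2.trans (Le.add hs (Le.refl C _))
  -- A itself need not be convex; directedness makes its upward closure convex.
  · have hconv : Convex ℝ {b | ∃ a ∈ A, Le C a b} := by
      rintro b ⟨b', hb', hb⟩ c ⟨c', hc', hc⟩ p q hp hq hpq
      obtain ⟨d, hd, hdb, hdc⟩ := hd b' hb' c' hc'
      refine ⟨d, hd, ?_⟩
      have := ((hdb.trans hb).smul hp).add ((hdc.trans hc).smul hq)
      rwa [← add_smul, hpq, one_smul] at this
    obtain ⟨s, ⟨a, ha, has⟩, h1, -⟩ := happ _ hconv
      (Filter.mem_of_superset (hU ⟨a₀, ha₀⟩) fun b hb => ⟨b, hb.1, Le.refl C b⟩) ε hε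
    exact ⟨a, ha, has.trans h1⟩

/-! ### Positive functionals, pure functionals and states. -/

section Functionals

variable {V : Type*} [AddCommGroup V] [Module ℝ V] {C : PointedCone ℝ V} {u : V}

/-- A linear functional which is nonnegative on the cone. -/
def IsPositive (C : PointedCone ℝ V) (φ : V →ₗ[ℝ] ℝ) : Prop := ∀ v ∈ C, 0 ≤ φ v

/-- A nonzero positive functional which spans an extreme ray of the dual cone. -/
structure IsPure (C : PointedCone ℝ V) (φ : V →ₗ[ℝ] ℝ) : Prop where
  isPositive : IsPositive C φ
  ne_zero : φ ≠ 0
  exists_eq_smul : ∀ ψ : V →ₗ[ℝ] ℝ, IsPositive C ψ → IsPositive C (φ - ψ) → ∃ t : ℝ, ψ = t • φ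

theorem IsPositive.mono {φ : V →ₗ[ℝ] ℝ} (h : IsPositive C φ) {x y : V} (hxy : Le C x y) :
    φ x ≤ φ y := by
  have := h _ hxy
  rw [map_sub] at this
  linarith

theorem IsPositive.smul {φ : V →ₗ[ℝ] ℝ} (h : IsPositive C φ) {t : ℝ} (ht : 0 ≤ t) :
    IsPositive C (t • φ) := fun v hv => mul_nonneg ht (h v hv)

theorem IsPositive.eq_zero {φ : V →ₗ[ℝ] ℝ} (h : IsPositive C φ) (hu : IsOrderUnit C u)
    (h0 : φ u = 0) : φ = 0 := by
  ext v
  obtain ⟨t, -, h1, h2⟩ := hu.2 v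
  have h1 := h.mono h1
  have h2 := h.mono h2
  simp only [map_neg, map_smul, h0, smul_zero, neg_zero] at h1 h2
  exact le_antisymm h2 h1

theorem IsPure.apply_pos {φ : V →ₗ[ℝ] ℝ} (h : IsPure C φ) (hu : IsOrderUnit C u) : 0 < φ u :=
  (h.isPositive u hu.1).lt_of_ne' fun h0 => h.ne_zero (h.isPositive.eq_zero hu h0)

theorem isPositive_of_forall_isOrderUnit {φ : V →ₗ[ℝ] ℝ} (hu : IsOrderUnit C u)
    (h : ∀ x, IsOrderUnit C x → 0 ≤ φ x) : IsPositive C φ := by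
  intro v hv
  refine le_of_forall_pos_le_add fun ε hε => ?_
  have hs : 0 < |φ u| + 1 := by positivity
  have h1 := h _ (hu.mem_add_smul hv (div_pos hε hs))
  rw [map_add, map_smul, smul_eq_mul] at h1
  refine h1.trans (add_le_add_right ?_ _)
  rw [div_mul_eq_mul_div, div_le_iff₀ hs]
  exact mul_le_mul_of_nonneg_left (by linarith [le_abs_self (φ u)]) hε.le

/-- A sublinear function is supported by a linear functional at every point. -/
theorem exists_linear_le_sublinear {E : Type*} [AddCommGroup E] [Module ℝ E] (N : E → ℝ)
    (hN : ∀ c : ℝ, 0 < c → ∀ x, N (c • x) = c * N x) (hadd : ∀ x y, N (x + y) ≤ N x + N y) (a : E) :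
    ∃ f : E →ₗ[ℝ] ℝ, (∀ x, f x ≤ N x) ∧ f a = N a := by
  have h0 : N 0 = 0 := by
    have := hN 2 two_pos 0
    rw [smul_zero] at this
    linarith
  have key : ∀ c : ℝ, c * N a ≤ N (c • a) := by
    intro c
    rcases lt_trichotomy c 0 with hc | rfl | hc
    · have h1 := hN (-c) (neg_pos.2 hc) a
      have h2 := hadd (c • a) (-c • a)
      rw [← add_smul, add_neg_cancel, zero_smul, h0, h1] at h2
      linarith
    · simp [h0]
    · exact (hN c hc a).ge
  -- Well-definedness of c • a ↦ c N(a), which has content only when a = 0.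
  have H : ∀ c : ℝ, c • a = 0 → (RingHom.id ℝ) c • N a = 0 := by
    intro c hc
    rcases eq_or_ne c 0 with rfl | hc0
    · simp
    · rw [(smul_eq_zero.1 hc).resolve_left hc0, h0, smul_zero]
  obtain ⟨g, hg, hgN⟩ := exists_extension_of_le_sublinear (LinearPMap.mkSpanSingleton' a (N a) H) N
    hN hadd (by
      rintro ⟨x, hx⟩
      obtain ⟨c, rfl⟩ := Submodule.mem_span_singleton.1 hx
      rw [LinearPMap.mkSpanSingleton'_apply]
      exact key c)
  refine ⟨g, hgN, ?_⟩
  exact (hg ⟨a, Submodule.mem_span_singleton_self a⟩).trans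
    (LinearPMap.mkSpanSingleton'_apply_self a (N a) H _)

/-- Hahn–Banach for the sublinear gauge M(·/u), supported at v. Its values at -x (x ∈ C), u and -u
are at most 0, 1 and -1, which forces a state. -/
theorem IsOrderUnitSpace.exists_state [Nontrivial V] (h : IsOrderUnitSpace C u) (v : V) :
    ∃ φ : V →ₗ[ℝ] ℝ, IsPositive C φ ∧ φ u = 1 ∧ Le C v (φ v • u) := by
  obtain ⟨f, hf, hfv⟩ := exists_linear_le_sublinear (fun x => orderGauge C x u)
    (fun c hc x => h.orderGauge_smul hc x) h.orderGauge_add_le v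
  refine ⟨f, fun x hx => ?_, le_antisymm ?_ ?_, ?_⟩
  · have h1 := (hf (-x)).trans (h.orderGauge_le (μ := 0) (by simpa [Le] using hx))
    rw [map_neg] at h1
    linarith
  · exact (hf u).trans (h.orderGauge_le (by simp [Le]))
  · have h1 := (hf (-u)).trans (h.orderGauge_le (μ := -1) (by simp [Le]))
    rw [map_neg] at h1
    linarith
  · rw [hfv]
    exact h.le_orderGauge_smul v

/-- The open half-space `φ < 1` of a pure functional is upward directed. -/
theorem IsPure.exists_upper_bound {φ : V →ₗ[ℝ] ℝ} (h : IsPure C φ) (hu : IsOrderUnit C u) {a b : V}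
    (ha : φ a < 1) (hb : φ b < 1) : ∃ y, Le C a y ∧ Le C b y ∧ φ y < 1 := by
  -- N(a, b) is the infimum of φ over common upper bounds of a and b. A functional f ≤ N exact at
  -- (a, b) is positive and restricts to φ on the diagonal; purity then forces f(v, w) = tφ(v) + (1
  -- - t)φ(w) with 0 ≤ t ≤ 1, so N(a, b) ≤ max(φ(a), φ(b)) < 1.
  let S : V × V → Set ℝ := fun p => {s | ∃ y, Le C p.1 y ∧ Le C p.2 y ∧ φ y = s}
  let N : V × V → ℝ := fun p => sInf (S p)
  have hbdd : ∀ p, BddBelow (S p) := by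
    rintro p
    refine ⟨φ p.1, ?_⟩
    rintro _ ⟨y, h1, -, rfl⟩
    exact h.isPositive.mono h1
  have hne : ∀ p, (S p).Nonempty := by
    rintro p
    obtain ⟨s, hs, h1⟩ := hu.exists_le p.1
    obtain ⟨t, ht, h2⟩ := hu.exists_le p.2
    exact ⟨_, (s + t) • u, h1.trans (smul_le_smul_of_mem hu.1 (by linarith)),
      h2.trans (smul_le_smul_of_mem hu.1 (by linarith)), rfl⟩
  have hle : ∀ p y, Le C p.1 y → Le C p.2 y → N p ≤ φ y := fun p y h1 h2 =>
    csInf_le (hbdd p) ⟨y, h1, h2, rfl⟩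
  have happrox : ∀ p, ∀ s, N p < s → ∃ y, Le C p.1 y ∧ Le C p.2 y ∧ φ y < s := by
    intro p s hs
    obtain ⟨_, ⟨y, h1, h2, rfl⟩, hy⟩ := exists_lt_of_csInf_lt (hne p) hs
    exact ⟨y, h1, h2, hy⟩
  have hsmul_le : ∀ c : ℝ, 0 < c → ∀ p, N (c • p) ≤ c * N p := by
    intro c hc p
    rw [mul_comm, ← div_le_iff₀ hc]
    refine le_csInf (hne p) ?_
    rintro _ ⟨y, h1, h2, rfl⟩
    rw [div_le_iff₀ hc, mul_comm]
    have := hle (c • p) (c • y) (h1.smul hc.le) (h2.smul hc.le)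
    rwa [map_smul] at this
  have hsmul : ∀ c : ℝ, 0 < c → ∀ p, N (c • p) = c * N p := by
    intro c hc p
    refine le_antisymm (hsmul_le c hc p) ?_
    have := hsmul_le c⁻¹ (inv_pos.2 hc) (c • p)
    rwa [smul_smul, inv_mul_cancel₀ hc.ne', one_smul, inv_mul_eq_div, le_div_iff₀ hc, mul_comm]
      at this
  have hadd : ∀ p q, N (p + q) ≤ N p + N q := by
    intro p q
    refine le_of_forall_pos_le_add fun ε hε => ?_
    obtain ⟨y, h1, h2, h3⟩ := happrox p (N p + ε / 2) (by linarith)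
    obtain ⟨z, h4, h5, h6⟩ := happrox q (N q + ε / 2) (by linarith)
    have := hle (p + q) (y + z) (h1.add h4) (h2.add h5)
    rw [map_add] at this
    linarith
  obtain ⟨f, hf, hfab⟩ := exists_linear_le_sublinear N hsmul hadd (a, b)
  have hneg : ∀ p : V × V, p.1 ∈ C → p.2 ∈ C → 0 ≤ f p := by
    intro p h1 h2
    have := (hf (-p)).trans (hle (-p) 0 (by simpa [Le] using h1) (by simpa [Le] using h2))
    rw [map_neg, map_zero] at this
    linarith
  have hdiag : ∀ v, f (v, v) = φ v := by
    intro v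
    refine le_antisymm ((hf _).trans (hle _ v (Le.refl C v) (Le.refl C v))) ?_
    have := (hf (-v, -v)).trans (hle _ (-v) (Le.refl C _) (Le.refl C _))
    rw [← Prod.neg_mk, map_neg, map_neg] at this
    linarith
  have hsplit : ∀ v w, f (v, w) = f (v, 0) + f (0, w) := fun v w => by
    rw [← map_add]; simp
  obtain ⟨t, ht⟩ := h.exists_eq_smul (f ∘ₗ LinearMap.inl ℝ V V)
    (fun v hv => hneg (v, 0) hv C.zero_mem) (fun v hv => by
      have h1 := hdiag v
      rw [hsplit] at h1
      have h2 := hneg (0, v) C.zero_mem hv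
      simp only [LinearMap.sub_apply, LinearMap.comp_apply, LinearMap.inl_apply]
      linarith)
  have ht' : ∀ v, f (v, 0) = t * φ v := fun v => by
    simpa using LinearMap.congr_fun ht v
  have ht2 : ∀ v, f (0, v) = (1 - t) * φ v := fun v => by
    have h1 := hdiag v
    rw [hsplit, ht'] at h1
    linarith
  have hφu := h.apply_pos hu
  have h0t : 0 ≤ t := by
    have h1 := hneg (u, 0) hu.1 C.zero_mem
    rw [ht'] at h1
    exact nonneg_of_mul_nonneg_left h1 hφu
  have ht1 : 0 ≤ 1 - t := by
    have h1 := hneg (0, u) C.zero_mem hu.1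
    rw [ht2] at h1
    exact nonneg_of_mul_nonneg_left h1 hφu
  refine happrox (a, b) 1 ?_
  rw [← hfab, hsplit, ht', ht2]
  calc t * φ a + (1 - t) * φ b ≤ t * max (φ a) (φ b) + (1 - t) * max (φ a) (φ b) :=
        add_le_add (mul_le_mul_of_nonneg_left (le_max_left _ _) h0t)
          (mul_le_mul_of_nonneg_left (le_max_right _ _) ht1)
    _ = max (φ a) (φ b) := by ring
    _ < 1 := max_lt ha hb

/-- The states of `(V, C, u)`, as a set of real functions on `V`. -/
def stateSet (C : PointedCone ℝ V) (u : V) : Set (V → ℝ) :=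
  {f | ∃ φ : V →ₗ[ℝ] ℝ, IsPositive C φ ∧ φ u = 1 ∧ ⇑φ = f}

/-- Banach–Alaoglu in the product topology: the states are cut out by pointwise closed conditions
inside a product of intervals [-t v, t v]. -/
theorem IsOrderUnit.isCompact_stateSet (h : IsOrderUnit C u) : IsCompact (stateSet C u) := by
  choose t _ ht using h.2
  have heq : stateSet C u = {f : V → ℝ | (∀ x y, f (x + y) = f x + f y) ∧
      (∀ (c : ℝ) x, f (c • x) = c * f x) ∧ (∀ x ∈ C, 0 ≤ f x) ∧ f u = 1} := by
    ext f
    constructor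
    · rintro ⟨φ, h1, h2, rfl⟩
      exact ⟨map_add φ, fun c x => map_smul φ c x, h1, h2⟩
    · rintro ⟨h1, h2, h3, h4⟩
      exact ⟨{ toFun := f, map_add' := h1, map_smul' := h2 }, h3, h4, rfl⟩
  have hclosed : IsClosed (stateSet C u) := by
    simp only [heq, Set.ofPred_and, Set.ofPred_forall]
    refine IsClosed.inter (isClosed_iInter fun x => isClosed_iInter fun y => ?_)
      (IsClosed.inter (isClosed_iInter fun c => isClosed_iInter fun x => ?_)
      (IsClosed.inter (isClosed_iInter fun x => isClosed_iInter fun _ => ?_) ?_))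
    · exact isClosed_eq (by fun_prop) (by fun_prop)
    · exact isClosed_eq (by fun_prop) (by fun_prop)
    · exact isClosed_le (by fun_prop) (by fun_prop)
    · exact isClosed_eq (by fun_prop) (by fun_prop)
  refine (isCompact_univ_pi fun v => isCompact_Icc (a := -t v) (b := t v)).of_isClosed_subset
    hclosed ?_
  rintro _ ⟨φ, hφ, hφu, rfl⟩ v -
  have h1 := hφ.mono (ht v).1
  have h2 := hφ.mono (ht v).2
  simp only [map_neg, map_smul, hφu, smul_eq_mul, mul_one] at h1 h2
  exact ⟨h1, h2⟩

end Functionals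

/-! ### Order-reversing maps and dominated functionals. -/

section OrderReversing

variable {V W : Type*} [AddCommGroup V] [Module ℝ V] [AddCommGroup W] [Module ℝ W]
  {C : PointedCone ℝ V} {K : PointedCone ℝ W} {Φ : V → W} {u w r x y : V} {e : W}
  {φ ψ : W →ₗ[ℝ] ℝ}

/-- `Φ` maps the order units of `C` onto those of `K`, reversing the order up to scalars. -/
structure IsOrderReversing (C : PointedCone ℝ V) (K : PointedCone ℝ W) (Φ : V → W) : Prop where
  isOrderUnit : ∀ x, IsOrderUnit C x → IsOrderUnit K (Φ x)
  exists_eq : ∀ y, IsOrderUnit K y → ∃ x, IsOrderUnit C x ∧ Φ x = y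
  le_iff : ∀ x y, IsOrderUnit C x → IsOrderUnit C y → ∀ μ : ℝ, 0 < μ →
    (Le C x (μ • y) ↔ Le K (Φ y) (μ • Φ x))

/-- The functional `φ` is bounded by the gauge of `w` transported along `Φ`. -/
def IsDominatedBy (C : PointedCone ℝ V) (Φ : V → W) (φ : W →ₗ[ℝ] ℝ) (w : V) : Prop :=
  ∀ x, IsOrderUnit C x → ∀ μ : ℝ, 0 < μ → Le C w (μ • x) → φ (Φ x) ≤ μ

/-- The functional `φ` is the gauge of `r` transported along `Φ`. -/
def Represents (C : PointedCone ℝ V) (Φ : V → W) (φ : W →ₗ[ℝ] ℝ) (r : V) : Prop :=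
  ∀ x, IsOrderUnit C x → ∀ μ : ℝ, 0 < μ → (Le C r (μ • x) ↔ φ (Φ x) ≤ μ)

theorem IsOrderReversing.le (h : IsOrderReversing C K Φ) (hx : IsOrderUnit C x)
    (hy : IsOrderUnit C y) {μ : ℝ} (hμ : 0 < μ) (hxy : Le C x (μ • y)) : Le K (Φ y) (μ • Φ x) :=
  (h.le_iff x y hx hy μ hμ).1 hxy

theorem IsOrderReversing.le_iff_le (h : IsOrderReversing C K Φ) (hx : IsOrderUnit C x)
    (hy : IsOrderUnit C y) : Le C x y ↔ Le K (Φ y) (Φ x) := by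
  simpa using h.le_iff x y hx hy 1 one_pos

theorem IsOrderReversing.map_smul (h : IsOrderReversing C K Φ) (hW : IsOrderUnitSpace K e)
    (hx : IsOrderUnit C x) {t : ℝ} (ht : 0 < t) : Φ (t • x) = t⁻¹ • Φ x := by
  refine hW.antisymm (h.le hx (hx.smul ht) (inv_pos.2 ht) ?_)
    (Le.of_le_smul ht (h.le (hx.smul ht) hx ht (Le.refl C _)))
  rw [smul_smul, inv_mul_cancel₀ ht.ne', one_smul]
  exact Le.refl C _

/-- Since w may lie outside the interior, Φw is unavailable; testing at the perturbations w + εu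
suffices, because w ≤ μx implies w + ε'u ≤ (μ + ε)x for small ε'. -/
theorem isDominatedBy_of_forall_add (h : IsOrderReversing C K Φ) (hw : w ∈ C)
    (hu : IsOrderUnit C u) (hψ : IsPositive K ψ)
    (hb : ∀ ε : ℝ, 0 < ε → ψ (Φ (w + ε • u)) ≤ 1) : IsDominatedBy C Φ ψ w := by
  intro x hx μ hμ hwx
  obtain ⟨t, ht, hut⟩ := hx.exists_le u
  refine le_of_forall_pos_le_add fun ε hε => ?_
  have hε' : 0 < ε * t⁻¹ := by positivity
  have h1 : Le C (w + (ε * t⁻¹) • u) ((μ + ε) • x) := by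
    have := hwx.add (hut.smul hε'.le)
    rwa [smul_smul (ε * t⁻¹), mul_assoc, inv_mul_cancel₀ ht.ne', mul_one, ← add_smul] at this
  have h2 := hψ.mono (h.le (hu.mem_add_smul hw hε') hx (by linarith) h1)
  rw [LinearMap.map_smul, smul_eq_mul] at h2
  nlinarith [hb _ hε']

/-- The states of `(W, K, Φ u)` whose multiple by `c` is dominated by `w`. -/
def dominatedStates (K : PointedCone ℝ W) (Φ : V → W) (u w : V) (c : ℝ) :
    Set (W → ℝ) :=
  stateSet K (Φ u) ∩ ⋂ ε : {ε : ℝ // 0 < ε}, {f | c * f (Φ (w + (ε : ℝ) • u)) ≤ 1}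

theorem isCompact_dominatedStates (h : IsOrderReversing C K Φ) (hu : IsOrderUnit C u) (w : V)
    (c : ℝ) : IsCompact (dominatedStates K Φ u w c) :=
  (h.isOrderUnit u hu).isCompact_stateSet.inter_right
    (isClosed_iInter fun _ => isClosed_le (by fun_prop) (by fun_prop))

/-- By compactness only finitely many ε matter, and the smallest is the strictest. For it, a state ψ
at Φ(w + εu) supporting Φu has ψ(Φu) ≥ M(w/u), so normalising ψ at Φu keeps the bound. -/
theorem dominatedStates_nonempty [Nontrivial V] [Nontrivial W] (h : IsOrderReversing C K Φ)
    (hV : IsOrderUnitSpace C u) (hW : IsOrderUnitSpace K e) (hw : w ∈ C)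
    (hc : 0 < orderGauge C w u) : (dominatedStates K Φ u w (orderGauge C w u)).Nonempty := by
  set c := orderGauge C w u
  have hu := hV.isOrderUnit
  have hΦu := h.isOrderUnit u hu
  refine hΦu.isCompact_stateSet.inter_iInter_nonempty _
    (fun ε => isClosed_le (by fun_prop) (by fun_prop)) fun s => ?_
  obtain ⟨ε, hε, hεs⟩ : ∃ ε : ℝ, 0 < ε ∧ ∀ δ ∈ s, ε ≤ δ := by
    rcases s.eq_empty_or_nonempty with rfl | hs
    · exact ⟨1, one_pos, by simp⟩
    · obtain ⟨δ, -, hδ⟩ := s.exists_min_image (fun δ => (δ : ℝ)) hs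
      exact ⟨δ, δ.2, hδ⟩
  have hwε := hu.mem_add_smul hw hε
  obtain ⟨ψ, hψ, hψ1, hle⟩ := (hW.of_isOrderUnit (h.isOrderUnit _ hwε)).exists_state (Φ u)
  have hpos : 0 < ψ (Φ u) := (hψ _ hΦu.1).lt_of_ne' fun h0 => by
    have := hψ.eq_zero hΦu h0
    simp [this] at hψ1
  have h1 := (h.le_iff _ u hwε hu _ hpos).2 hle
  have h2 : c ≤ ψ (Φ u) :=
    hV.orderGauge_le ((le_add_of_mem w (smul_mem_cone hu.1 hε.le)).trans h1)
  refine ⟨⇑((ψ (Φ u))⁻¹ • ψ), ⟨_, hψ.smul (inv_pos.2 hpos).le, ?_, rfl⟩, ?_⟩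
  · simp [hpos.ne']
  · simp only [Set.mem_iInter]
    intro δ hδ
    have h3 := hψ.mono ((h.le_iff_le hwε (hu.mem_add_smul hw δ.2)).1
      ((Le.refl C w).add (smul_le_smul_of_mem hu.1 (hεs δ hδ))))
    rw [hψ1] at h3
    have h4 : 0 ≤ ψ (Φ (w + (δ : ℝ) • u)) := hψ _ (h.isOrderUnit _ (hu.mem_add_smul hw δ.2)).1
    change c * ((ψ (Φ u))⁻¹ * ψ (Φ (w + (δ : ℝ) • u))) ≤ 1
    rw [mul_left_comm, inv_mul_le_iff₀ hpos]
    nlinarith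

/-- The transported gauge of `w` is supported by a dominated positive functional at every order
unit. -/
theorem exists_isDominatedBy [Nontrivial V] [Nontrivial W] (h : IsOrderReversing C K Φ)
    (hV : IsOrderUnitSpace C u) (hW : IsOrderUnitSpace K e) (hw : w ∈ C) (hx : IsOrderUnit C x) :
    ∃ ψ : W →ₗ[ℝ] ℝ, IsPositive K ψ ∧ IsDominatedBy C Φ ψ w ∧ Le C w (ψ (Φ x) • x) := by
  have hV' := hV.of_isOrderUnit hx
  rcases (hV'.orderGauge_nonneg hw).eq_or_lt with h0 | hc
  · refine ⟨0, fun _ _ => le_rfl, fun _ _ μ hμ _ => hμ.le, ?_⟩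
    simpa [← h0] using hV'.le_orderGauge_smul w
  · obtain ⟨_, ⟨ψ, hψ, hψ1, rfl⟩, hb⟩ := dominatedStates_nonempty h hV' hW hw hc
    simp only [Set.mem_iInter] at hb
    refine ⟨orderGauge C w x • ψ, hψ.smul hc.le,
      isDominatedBy_of_forall_add h hw hx (hψ.smul hc.le) fun ε hε => hb ⟨ε, hε⟩, ?_⟩
    simpa [hψ1] using hV'.le_orderGauge_smul w

/-! ### Pure functionals as extreme vectors. -/

/-- The vector r is the infimum of the order units x with φ(Φx) < 1. Being a lower bound yields
M(r/x) ≤ φ(Φx); the approximation in norm yields the reverse. -/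
theorem IsPure.exists_represents (hφ : IsPure K φ) (h : IsOrderReversing C K Φ)
    (hV : IsOrderUnitSpace C u) (hW : IsOrderUnitSpace K e) (hinf : HasDirectedInf C u) :
    ∃ r ∈ C, Represents C Φ φ r := by
  have hpos : ∀ x, IsOrderUnit C x → 0 < φ (Φ x) := fun x hx => hφ.apply_pos (h.isOrderUnit x hx)
  have hscale : ∀ x, IsOrderUnit C x → ∀ μ, φ (Φ x) < μ →
      IsOrderUnit C (μ • x) ∧ φ (Φ (μ • x)) < 1 := by
    intro x hx μ hμ
    have hμ0 := (hpos x hx).trans hμ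
    refine ⟨hx.smul hμ0, ?_⟩
    rw [h.map_smul hW hx hμ0, LinearMap.map_smul, smul_eq_mul, inv_mul_lt_iff₀ hμ0, mul_one]
    exact hμ
  obtain ⟨r, hr, hle, happ⟩ := hinf {x | IsOrderUnit C x ∧ φ (Φ x) < 1}
    ⟨_, hscale u hV.isOrderUnit _ (lt_add_one _)⟩ (fun x hx => hx.1.1) (by
      rintro x ⟨hx, hx1⟩ y ⟨hy, hy1⟩
      obtain ⟨z, hxz, hyz, hz1⟩ := hφ.exists_upper_bound hW.isOrderUnit hx1 hy1
      obtain ⟨t, ht, rfl⟩ := h.exists_eq z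
        ((h.isOrderUnit x hx).of_le one_pos (by rwa [one_smul]))
      exact ⟨t, ⟨ht, hz1⟩, (h.le_iff_le ht hx).2 hxz, (h.le_iff_le ht hy).2 hyz⟩)
  refine ⟨r, hr, fun x hx μ hμ => ⟨fun hrx => ?_, fun hxμ => ?_⟩⟩
  · obtain ⟨t, ht, hut⟩ := hx.exists_le u
    refine le_of_forall_pos_le_add fun ε hε => ?_
    obtain ⟨a, ⟨ha, ha1⟩, har⟩ := happ (ε * t⁻¹) (by positivity)
    have h1 := hut.smul (show 0 ≤ ε * t⁻¹ by positivity)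
    rw [smul_smul (ε * t⁻¹), mul_assoc, inv_mul_cancel₀ ht.ne', mul_one] at h1
    have h2 := har.trans (hrx.add h1)
    rw [← add_smul] at h2
    have h3 := hφ.isPositive.mono (h.le ha hx (by linarith) h2)
    rw [LinearMap.map_smul, smul_eq_mul] at h3
    nlinarith
  · exact hV.le_smul_of_forall_lt fun ν hν => hle _ (hscale x hx ν (hxμ.trans_lt hν))

/-- For w ≤ r, a functional dominated by w lies below φ, hence equals tφ. Domination gives tr ≤ w,
and support at x gives w ≤ tφ(Φx)x. -/
theorem Represents.isExtremeVector [Nontrivial V] [Nontrivial W] (hr : Represents C Φ φ r)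
    (hrC : r ∈ C) (hφ : IsPure K φ) (h : IsOrderReversing C K Φ) (hV : IsOrderUnitSpace C u)
    (hW : IsOrderUnitSpace K e) : IsExtremeVector C r := by
  have hu := hV.isOrderUnit
  have hpos : ∀ x, IsOrderUnit C x → 0 < φ (Φ x) := fun x hx => hφ.apply_pos (h.isOrderUnit x hx)
  refine ⟨hrC, ?_, fun w hw hwr => ?_⟩
  · rintro rfl
    have hφu := hpos u hu
    have := (hr u hu (φ (Φ u) / 2) (by linarith)).1
      (le_of_zero_le (smul_mem_cone hu.1 (by linarith)))
    linarith
  have hw : w ∈ C := by simpa [Le] using hw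
  have key : ∀ x, IsOrderUnit C x →
      ∃ t : ℝ, 0 ≤ t ∧ Le C (t • r) w ∧ Le C w ((t * φ (Φ x)) • x) := by
    intro x hx
    obtain ⟨ψ, hψ, hdom, hle⟩ := exists_isDominatedBy h hV hW hw hx
    have hsub : IsPositive K (φ - ψ) := by
      refine isPositive_of_forall_isOrderUnit hW.isOrderUnit fun y hy => ?_
      obtain ⟨z, hz, rfl⟩ := h.exists_eq y hy
      exact sub_nonneg.2 (hdom z hz _ (hpos z hz)
        (hwr.trans ((hr z hz _ (hpos z hz)).2 le_rfl)))
    obtain ⟨t, rfl⟩ := hφ.exists_eq_smul ψ hψ hsub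
    have ht : 0 ≤ t := nonneg_of_mul_nonneg_left (hψ _ (h.isOrderUnit u hu).1) (hpos u hu)
    refine ⟨t, ht, ?_, hle⟩
    rcases ht.eq_or_lt with rfl | ht
    · rw [zero_smul]
      exact le_of_zero_le hw
    refine hV.le_of_forall_le_add (v := u) fun ε hε => ?_
    have hwε := hu.mem_add_smul hw hε
    have h1 := hdom _ hwε 1 one_pos
      (by rw [one_smul]; exact le_add_of_mem w (smul_mem_cone hu.1 hε.le))
    have h2 : φ (Φ (w + ε • u)) ≤ t⁻¹ := by
      rwa [LinearMap.smul_apply, smul_eq_mul, mul_comm, ← le_div_iff₀ ht, one_div] at h1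
    simpa using ((hr _ hwε _ (inv_pos.2 ht)).2 h2).of_le_smul (inv_pos.2 ht)
  obtain ⟨t, ht, htr, htu⟩ := key u hu
  refine ⟨t, ht, hV.antisymm ?_ htr⟩
  -- The multiple depends on the point of support. Using r + εu, where φ∘Φ ≤ 1, gives a multiple s;
  -- comparison at u shows s ≤ t, so w ≤ t(r + εu).
  refine hV.le_of_forall_le_add (v := t • u) fun ε hε => ?_
  have hrε := hu.mem_add_smul hrC hε
  have h1 : φ (Φ (r + ε • u)) ≤ 1 := (hr _ hrε 1 one_pos).1
    (by rw [one_smul]; exact le_add_of_mem r (smul_mem_cone hu.1 hε.le))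
  obtain ⟨s, hs, hsr, hsx⟩ := key _ hrε
  have hst : s ≤ t := by
    rcases hs.eq_or_lt with rfl | hs
    · exact ht
    have h2 := (hsr.trans htu).of_smul hs
    rw [smul_smul] at h2
    -- Needed because `Represents` speaks only of μ > 0; t = 0 would give r ≤ 0.
    have h3 : 0 < t := by
      by_contra! h0
      obtain rfl : t = 0 := le_antisymm h0 ht
      have h4 := (hr u hu (φ (Φ u) / 2) (by linarith [hpos u hu])).1 (h2.trans (by
        simpa using le_of_zero_le (smul_mem_cone hu.1 (by linarith [hpos u hu]))))
      linarith [hpos u hu]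
    have h5 := (hr u hu _ (mul_pos (inv_pos.2 hs) (mul_pos h3 (hpos u hu)))).1 h2
    rw [← mul_assoc, le_mul_iff_one_le_left (hpos u hu), inv_mul_eq_div, one_le_div hs] at h5
    exact h5
  have h6 := hsx.trans (smul_le_smul_of_mem hrε.1
    (show s * φ (Φ (r + ε • u)) ≤ t by nlinarith [hpos _ hrε]))
  rwa [smul_add, smul_comm t ε u] at h6

theorem Represents.le_of_isDominatedBy (hr : Represents C Φ φ r) (hV : IsOrderUnitSpace C u)
    (hw : w ∈ C) (hdom : IsDominatedBy C Φ φ w) : Le C r w := by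
  refine hV.le_of_forall_le_add (v := u) fun ε hε => ?_
  have hwε := hV.isOrderUnit.mem_add_smul hw hε
  have := (hr _ hwε 1 one_pos).2 (hdom _ hwε 1 one_pos
    (by rw [one_smul]; exact le_add_of_mem w (smul_mem_cone hV.isOrderUnit.1 hε.le)))
  rwa [one_smul] at this

/-! ### Pure states dominated by a vector. -/

/-- Makes the dominated states a face. As w + ηu ≤ (1 + η)u, the summand χ is at least χ(Φu)/(1 + η)
at Φ(w + ηu), leaving ψ at most 1 - χ(Φu)/(1 + η), which tends to ψ(Φu) as η → 0. -/
theorem apply_le_of_add_le (h : IsOrderReversing C K Φ) (hu : IsOrderUnit C u) (hw : w ∈ C)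
    (hwu : Le C w u) {χ : W →ₗ[ℝ] ℝ} (hψ : IsPositive K ψ) (hχ : IsPositive K χ)
    (h1 : ψ (Φ u) + χ (Φ u) = 1)
    (hb : ∀ ε : ℝ, 0 < ε → ψ (Φ (w + ε • u)) + χ (Φ (w + ε • u)) ≤ 1) {ε : ℝ} (hε : 0 < ε) :
    ψ (Φ (w + ε • u)) ≤ ψ (Φ u) := by
  refine le_of_forall_pos_le_add fun δ hδ => ?_
  set η := min ε δ
  have hη : 0 < η := lt_min hε hδ
  have hwη := hu.mem_add_smul hw hη
  have h2 := hψ.mono ((h.le_iff_le hwη (hu.mem_add_smul hw hε)).1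
    ((Le.refl C w).add (smul_le_smul_of_mem hu.1 (min_le_left ε δ))))
  have h3 : Le C (w + η • u) ((1 + η) • u) := by
    rw [add_smul, one_smul]
    exact hwu.add (Le.refl C _)
  have h4 := hχ.mono (h.le hwη hu (by linarith) h3)
  rw [LinearMap.map_smul, smul_eq_mul] at h4
  have h5 := hb η hη
  have h6 : η ≤ δ := min_le_right ε δ
  have h7 := hψ _ (h.isOrderUnit _ hwη).1
  nlinarith

/-- A vector of gauge one relative to `u` dominates a pure state. -/
theorem exists_isPure_isDominatedBy [Nontrivial V] [Nontrivial W] (h : IsOrderReversing C K Φ)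
    (hV : IsOrderUnitSpace C u) (hW : IsOrderUnitSpace K e) (hw : w ∈ C)
    (h1 : orderGauge C w u = 1) :
    ∃ φ : W →ₗ[ℝ] ℝ, IsPure K φ ∧ φ (Φ u) = 1 ∧ IsDominatedBy C Φ φ w := by
  have hu := hV.isOrderUnit
  have hΦu := h.isOrderUnit u hu
  have hwu : Le C w u := by simpa [h1] using hV.le_orderGauge_smul w
  have hne := dominatedStates_nonempty h hV hW hw (by rw [h1]; exact one_pos)
  obtain ⟨f, hf⟩ := (isCompact_dominatedStates h hu w _).extremePoints_nonempty hne
  rw [h1, mem_extremePoints] at hf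
  obtain ⟨⟨⟨φ, hφ, hφ1, rfl⟩, hb⟩, hext⟩ := hf
  simp only [Set.mem_iInter] at hb
  have hb : ∀ ε : ℝ, 0 < ε → φ (Φ (w + ε • u)) ≤ 1 := fun ε hε => by simpa using hb ⟨ε, hε⟩
  refine ⟨φ, ⟨hφ, ?_, fun ψ hψ hχ => ?_⟩, hφ1, isDominatedBy_of_forall_add h hw hu hφ hb⟩
  · rintro rfl
    simp at hφ1
  have hmem : ∀ ψ χ : W →ₗ[ℝ] ℝ, IsPositive K ψ → IsPositive K χ → ψ + χ = φ → 0 < ψ (Φ u) →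
      ⇑((ψ (Φ u))⁻¹ • ψ) ∈ dominatedStates K Φ u w 1 := by
    rintro ψ χ hψ' hχ' rfl hpos
    refine ⟨⟨_, hψ'.smul (inv_pos.2 hpos).le, by simp [hpos.ne'], rfl⟩, ?_⟩
    simp only [Set.mem_iInter]
    intro ε
    have := apply_le_of_add_le h hu hw hwu hψ' hχ' hφ1 hb ε.2
    change 1 * ((ψ (Φ u))⁻¹ * ψ (Φ (w + (ε : ℝ) • u))) ≤ 1
    rwa [one_mul, inv_mul_le_iff₀ hpos, mul_one]
  have hsum : ψ (Φ u) + (φ - ψ) (Φ u) = 1 := by simp [hφ1]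
  rcases (hψ _ hΦu.1).eq_or_lt with h0 | hpos
  · exact ⟨0, by rw [hψ.eq_zero hΦu h0.symm, zero_smul]⟩
  rcases (hχ _ hΦu.1).eq_or_lt with h0 | hpos'
  · exact ⟨1, by rw [one_smul, ← sub_eq_zero.1 (hχ.eq_zero hΦu h0.symm)]⟩
  -- φ is a convex combination of the normalised ψ and φ - ψ, both in the face, so extremality
  -- identifies them with φ.
  have hseg := (hext _ (hmem ψ (φ - ψ) hψ hχ (by abel) hpos) _
    (hmem (φ - ψ) ψ hχ hψ (by abel) hpos')
    ⟨ψ (Φ u), (φ - ψ) (Φ u), hpos, hpos', hsum, ?_⟩).1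
  · refine ⟨ψ (Φ u), ?_⟩
    rw [← DFunLike.coe_injective hseg, smul_smul, mul_inv_cancel₀ hpos.ne', one_smul]
  · ext y
    simp only [LinearMap.coe_smul, Pi.add_apply, Pi.smul_apply, smul_eq_mul]
    rw [mul_inv_cancel_left₀ hpos.ne', mul_inv_cancel_left₀ hpos'.ne', LinearMap.sub_apply]
    ring

/-! ### Decomposition of order units into atoms. -/

/-- An atom relative to `u` which arises from a pure state. -/
def IsPureAtom (C : PointedCone ℝ V) (K : PointedCone ℝ W) (Φ : V → W) (u p : V) : Prop :=
  p ∈ C ∧ ∃ φ : W →ₗ[ℝ] ℝ, IsPure K φ ∧ φ (Φ u) = 1 ∧ Represents C Φ φ p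

theorem IsPureAtom.mem_atoms [Nontrivial V] [Nontrivial W] {p : V} (hp : IsPureAtom C K Φ u p)
    (h : IsOrderReversing C K Φ) (hV : IsOrderUnitSpace C u) (hW : IsOrderUnitSpace K e) :
    p ∈ atoms C u := by
  obtain ⟨hpC, φ, hφ, hφ1, hr⟩ := hp
  refine ⟨hr.isExtremeVector hpC hφ h hV hW, ?_⟩
  refine hV.orderGauge_eq ((hr u hV.isOrderUnit 1 one_pos).2 hφ1.le) (fun ν hν hle => ?_) hpC
  rw [← hφ1]
  exact (hr u hV.isOrderUnit ν hν).1 hle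

theorem exists_isPureAtom_le [Nontrivial V] [Nontrivial W] (h : IsOrderReversing C K Φ)
    (hV : IsOrderUnitSpace C u) (hW : IsOrderUnitSpace K e) (hinf : HasDirectedInf C u)
    (hw : w ∈ C) (h1 : orderGauge C w u = 1) : ∃ p, IsPureAtom C K Φ u p ∧ Le C p w := by
  obtain ⟨φ, hφ, hφ1, hdom⟩ := exists_isPure_isDominatedBy h hV hW hw h1
  obtain ⟨p, hp, hr⟩ := hφ.exists_represents h hV hW hinf
  exact ⟨p, ⟨hp, φ, hφ, hφ1, hr⟩, hr.le_of_isDominatedBy hV hw hdom⟩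

/-- A sum of pure atoms below `u` which is an order unit equals `u`. -/
theorem sum_eq_of_isOrderUnit (h : IsOrderReversing C K Φ) (hV : IsOrderUnitSpace C u)
    (hW : IsOrderUnitSpace K e) {l : List V} (hl : ∀ p ∈ l, IsPureAtom C K Φ u p)
    (hle : Le C l.sum u) (hs : IsOrderUnit C l.sum) : l.sum = u := by
  have hu := hV.isOrderUnit
  have hΦu := h.isOrderUnit u hu
  have hnonneg : ∀ l : List V, (∀ p ∈ l, p ∈ C) → l.sum ∈ C := fun l hl => list_sum_mem hl
  have hz : Le K (Φ u) (Φ l.sum) := (h.le_iff_le hs hu).1 hle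
  obtain ⟨t, ht, hts⟩ := hs.exists_le u
  have hple : ∀ p ∈ l, Le C p l.sum := by
    classical
    intro p hp
    rw [(List.perm_cons_erase hp).sum_eq, List.sum_cons]
    exact le_add_of_mem p (hnonneg _ fun q hq => (hl q (List.mem_of_mem_erase hq)).1)
  -- Let s be the sum and z = Φs - Φu ≥ 0. Each φ representing a summand has φ(z) ≤ 0, so every
  -- summand stays below the x with Φx = Φu + nz. Thus u ≤ ts ≤ const · x, and nz is bounded
  -- independently of n; the +1 keeps the constant positive for an empty list.
  have hbound : ∀ n : ℕ, Le K ((n : ℝ) • (Φ l.sum - Φ u)) ((t * (l.length + 1)) • Φ u) := by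
    intro n
    have hnz : (n : ℝ) • (Φ l.sum - Φ u) ∈ K := smul_mem_cone hz n.cast_nonneg
    obtain ⟨x, hx, hxe⟩ := h.exists_eq _ (hΦu.add_mem hnz)
    have hpx : ∀ p ∈ l, Le C p x := by
      intro p hp
      obtain ⟨-, φ, hφ, hφ1, hr⟩ := hl p hp
      have h1 := (hr _ hs 1 one_pos).1 (by rw [one_smul]; exact hple p hp)
      have h2 := (hr x hx 1 one_pos).2 (by
        rw [hxe, map_add, LinearMap.map_smul, map_sub, hφ1, smul_eq_mul]
        nlinarith [(n.cast_nonneg : (0 : ℝ) ≤ n)])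
      rwa [one_smul] at h2
    have hsum : ∀ l : List V, (∀ p ∈ l, Le C p x) → Le C l.sum ((l.length : ℝ) • x) := by
      intro l
      induction l with
      | nil => intro _; simpa using Le.refl C 0
      | cons p l ih =>
        intro hl
        have := (hl p (by simp)).add (ih fun q hq => hl q (by simp [hq]))
        rw [List.sum_cons, List.length_cons, Nat.cast_add, Nat.cast_one, add_comm (l.length : ℝ),
          add_smul, one_smul]
        exact this
    have h3 : Le C u ((t * (l.length + 1)) • x) := by
      refine hts.trans ?_
      rw [mul_smul]
      exact ((hsum l hpx).trans (smul_le_smul_of_mem hx.1 (by linarith))).smul ht.le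
    have h4 := h.le hu hx (by positivity) h3
    rw [hxe] at h4
    refine Le.trans ?_ h4
    rw [add_comm]
    exact le_add_of_mem _ hΦu.1
  have h0 := hW.archimedean _ _ (smul_mem_cone hΦu.1 (by positivity)) hbound
  have h1 : Le K (Φ l.sum) (Φ u) := by simpa [Le] using h0
  exact hV.antisymm hle ((h.le_iff_le hu hs).2 h1)

/-- If u - s ≤ νu with ν < 1, where s is the sum, then s ≥ (1 - ν)u is an order unit and so equals
u. Hence u - s has gauge one and dominates an atom. -/
theorem exists_isPureAtom_add_le [Nontrivial V] [Nontrivial W] (h : IsOrderReversing C K Φ)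
    (hV : IsOrderUnitSpace C u) (hW : IsOrderUnitSpace K e) (hinf : HasDirectedInf C u)
    {l : List V} (hl : ∀ p ∈ l, IsPureAtom C K Φ u p) (hle : Le C l.sum u) (hne : l.sum ≠ u) :
    ∃ p, IsPureAtom C K Φ u p ∧ Le C (p + l.sum) u := by
  have hs : l.sum ∈ C := list_sum_mem fun p hp => (hl p hp).1
  have h1 : orderGauge C (u - l.sum) u = 1 := by
    refine hV.orderGauge_eq (by simpa [Le] using hs) (fun ν _ hle' => ?_) hle
    by_contra! hlt
    refine hne (sum_eq_of_isOrderUnit h hV hW hl hle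
      (hV.isOrderUnit.of_le (sub_pos.2 hlt) ?_))
    unfold Le at hle' ⊢
    convert hle' using 1
    rw [sub_smul, one_smul]
    abel
  obtain ⟨p, hp, hpw⟩ := exists_isPureAtom_le h hV hW hinf hle h1
  refine ⟨p, hp, ?_⟩
  unfold Le at hpw ⊢
  convert hpw using 1
  abel

/-- Every order unit is a finite sum of pure atoms relative to it. -/
theorem exists_list_isPureAtom_sum_eq [Nontrivial V] [Nontrivial W] (h : IsOrderReversing C K Φ)
    (hV : IsOrderUnitSpace C u) (hW : IsOrderUnitSpace K e) (hinf : HasDirectedInf C u) :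
    ∃ l : List V, (∀ p ∈ l, IsPureAtom C K Φ u p) ∧ l.sum = u := by
  by_contra! hcon
  have hu := hV.isOrderUnit
  let T := {l : List V // (∀ p ∈ l, IsPureAtom C K Φ u p) ∧ Le C l.sum u}
  have step : ∀ l : T, ∃ l' : T, ∃ p, IsPureAtom C K Φ u p ∧ l'.1.sum = p + l.1.sum := by
    rintro ⟨l, hl, hle⟩
    obtain ⟨p, hp, hple⟩ := exists_isPureAtom_add_le h hV hW hinf hl hle (hcon l hl)
    exact ⟨⟨p :: l, by simpa using ⟨hp, hl⟩, by simpa using hple⟩, p, hp, by simp⟩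
  choose next p hp hnext using step
  let s : ℕ → T := fun n => next^[n] ⟨[], by simp, by simpa using le_of_zero_le hu.1⟩
  have hs : ∀ n, (s (n + 1)).1.sum = p (s n) + (s n).1.sum := fun n => by
    rw [show s (n + 1) = next (s n) from Function.iterate_succ_apply' next n _, hnext]
  have hmono : ∀ m n, m ≤ n → Le C (s m).1.sum (s n).1.sum := by
    intro m n hmn
    induction n, hmn using Nat.le_induction with
    | base => exact Le.refl C _
    | succ n _ ih =>
      refine ih.trans ?_
      rw [hs, add_comm]
      exact le_add_of_mem _ (hp _).1
  have hanti : ∀ m n, m ≤ n → Le C (u - (s n).1.sum) (u - (s m).1.sum) := fun m n hmn => by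
    have := hmono m n hmn
    unfold Le at this ⊢
    rwa [sub_sub_sub_cancel_left]
  obtain ⟨r, -, hr, happ⟩ := hinf (Set.range fun n => u - (s n).1.sum) ⟨_, 0, rfl⟩
    (by rintro _ ⟨n, rfl⟩; exact (s n).2.2) (by
      rintro _ ⟨m, rfl⟩ _ ⟨n, rfl⟩
      exact ⟨_, ⟨max m n, rfl⟩, hanti _ _ (le_max_left m n), hanti _ _ (le_max_right m n)⟩)
  -- Any constant below 1 works: the n-th remainder is within u/2 of the infimum, hence of the next
  -- remainder, and their difference is an atom of gauge one.
  obtain ⟨_, ⟨n, rfl⟩, hn⟩ := happ (1 / 2) (by norm_num)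
  have h1 : Le C (p (s n)) ((1 / 2 : ℝ) • u) := by
    have h2 := hn.trans ((hr _ ⟨n + 1, rfl⟩).add (Le.refl C _))
    beta_reduce at h2
    rw [hs] at h2
    unfold Le at h2 ⊢
    convert h2 using 1
    abel
  obtain ⟨-, φ, -, hφ1, hrep⟩ := hp (s n)
  have := (hrep u hu (1 / 2) (by norm_num)).1 h1
  rw [hφ1] at this
  norm_num at this

theorem exists_areOrthogonalAtoms_sum_eq [Nontrivial V] [Nontrivial W]
    (h : IsOrderReversing C K Φ) (hV : IsOrderUnitSpace C u) (hW : IsOrderUnitSpace K e)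
    (hinf : HasDirectedInf C u) :
    ∃ (n : ℕ) (p : Fin n → V), AreOrthogonalAtoms C u p ∧ ∑ i, p i = u := by
  obtain ⟨l, hl, hsum⟩ := exists_list_isPureAtom_sum_eq h hV hW hinf
  have hsum' : ∑ i : Fin l.length, l[(i : ℕ)] = u := by rw [Fin.sum_univ_getElem, hsum]
  refine ⟨l.length, fun i => l[(i : ℕ)], ⟨fun i => ?_, ?_⟩, hsum'⟩
  · exact (hl _ (List.getElem_mem i.2)).mem_atoms h hV hW
  · rw [hsum']
    exact Le.refl C u

/-- A gauge-reversing map, extended by zero, is order-reversing. -/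
theorem IsGaugeReversing.exists_isOrderReversing [Nontrivial V] [Nontrivial W]
    {hV : IsOrderUnitSpace C u} {hW : IsOrderUnitSpace K e}
    {Ψ : hV.coneInterior → hW.coneInterior} (hΨ : IsGaugeReversing hV hW Ψ) :
    ∃ Φ : V → W, IsOrderReversing C K Φ := by
  classical
  refine ⟨fun x => if hx : x ∈ hV.coneInterior then Ψ ⟨x, hx⟩ else 0, ?_, ?_, ?_⟩
  · intro x hx
    rw [dif_pos (hV.mem_coneInterior_iff.2 hx)]
    exact hW.mem_coneInterior_iff.1 (Subtype.prop _)
  · intro y hy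
    obtain ⟨x, hx⟩ := hΨ.1.2 ⟨y, hW.mem_coneInterior_iff.2 hy⟩
    refine ⟨x, hV.mem_coneInterior_iff.1 x.2, ?_⟩
    rw [dif_pos x.2, Subtype.coe_eta, hx]
  · intro x y hx hy μ _
    have hx' := hV.mem_coneInterior_iff.2 hx
    have hy' := hV.mem_coneInterior_iff.2 hy
    rw [dif_pos hx', dif_pos hy', (hV.of_isOrderUnit hy).le_smul_iff,
      (hW.of_isOrderUnit (hW.mem_coneInterior_iff.1 (Ψ ⟨x, hx'⟩).2)).le_smul_iff,
      hΨ.2 ⟨x, hx'⟩ ⟨y, hy'⟩]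

end OrderReversing

/-! ### Rescaling atoms and the main theorem. -/

theorem IsOrderUnitSpace.gauge_inv_smul_mem_atoms {V : Type*} [AddCommGroup V] [Module ℝ V]
    [Nontrivial V] {C : PointedCone ℝ V} {u r : V} (h : IsOrderUnitSpace C u)
    (hr : IsExtremeVector C r) :
    0 < orderGauge C r u ∧ (orderGauge C r u)⁻¹ • r ∈ atoms C u := by
  obtain ⟨hrC, hr0, hext⟩ := hr
  have hpos : 0 < orderGauge C r u := (h.orderGauge_nonneg hrC).lt_of_ne' fun h0 => hr0 <| by
    have := h.le_orderGauge_smul r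
    rw [h0, zero_smul] at this
    exact h.antisymm this (le_of_zero_le hrC)
  have hinv := inv_pos.2 hpos
  refine ⟨hpos, ⟨smul_mem_cone hrC hinv.le, smul_ne_zero hinv.ne' hr0, fun v hv hvr => ?_⟩, ?_⟩
  · obtain ⟨t, ht, hvt⟩ := hext _ (by simpa using hv.smul hpos.le) (by
      simpa using hvr.of_le_smul hinv)
    refine ⟨t, ht, ?_⟩
    rw [smul_comm, ← hvt, smul_smul, inv_mul_cancel₀ hpos.ne', one_smul]
  · rw [h.orderGauge_smul hinv, inv_mul_cancel₀ hpos.ne']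

end OrderUnit

theorem theoremT {V W : Type*} [AddCommGroup V] [Module ℝ V] [AddCommGroup W] [Module ℝ W]
    (C : PointedCone ℝ V) (u : V) (K : PointedCone ℝ W) (e : W)
    (hV : OrderUnit.IsOrderUnitSpace C u) (hW : OrderUnit.IsOrderUnitSpace K e)
    (hrefl : hV.IsReflexive)
    (Ψ : hV.coneInterior → hW.coneInterior) (hΨ : OrderUnit.IsGaugeReversing hV hW Ψ) :
    (∀ v : V, OrderUnit.IsOrderUnit C v →
      ∃ (n : ℕ) (p : Fin n → V), OrderUnit.AreOrthogonalAtoms C v p ∧ ∑ i, p i = v) ∧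
    hV.coneInterior ⊆ (PointedCone.hull ℝ (OrderUnit.atoms C u) : Set V) ∧
    Submodule.span ℝ (OrderUnit.atoms C u) = ⊤ := by
  open OrderUnit in
  rcases subsingleton_or_nontrivial V with _ | _
  · refine ⟨fun v _ => ⟨0, Fin.elim0, ⟨fun i => i.elim0, ?_⟩, Subsingleton.elim _ _⟩, ?_,
      Subsingleton.elim _ _⟩
    · rw [Subsingleton.elim v 0]
      exact Le.refl C 0
    · intro v _
      rw [Subsingleton.elim v 0]
      exact zero_mem _
  have hu := hV.isOrderUnit
  have : Nontrivial W := by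
    refine ⟨Ψ ⟨u, hV.mem_coneInterior_iff.2 hu⟩,
      Ψ ⟨(2 : ℝ) • u, hV.mem_coneInterior_iff.2 (hu.smul two_pos)⟩, fun heq => hV.ne_zero ?_⟩
    have := congrArg Subtype.val (hΨ.1.1 (Subtype.ext heq))
    simpa [two_smul] using this
  obtain ⟨Φ, hΦ⟩ := hΨ.exists_isOrderReversing
  have h1 : ∀ v : V, IsOrderUnit C v →
      ∃ (n : ℕ) (p : Fin n → V), AreOrthogonalAtoms C v p ∧ ∑ i, p i = v := fun v hv =>
    exists_areOrthogonalAtoms_sum_eq hΦ (hV.of_isOrderUnit hv) hW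
      ((hV.hasDirectedInf hrefl).of_isOrderUnit hv)
  have h2 : ∀ v : V, IsOrderUnit C v → v ∈ PointedCone.hull ℝ (atoms C u) := by
    intro v hv
    obtain ⟨n, p, ⟨hp, -⟩, rfl⟩ := h1 v hv
    refine sum_mem fun i _ => ?_
    obtain ⟨hpos, hatom⟩ := hV.gauge_inv_smul_mem_atoms (hp i).1
    have := smul_mem_cone (PointedCone.subset_hull hatom) hpos.le
    rwa [smul_smul, mul_inv_cancel₀ hpos.ne', one_smul] at this
  have h3 : ∀ v : V, IsOrderUnit C v → v ∈ Submodule.span ℝ (atoms C u) := fun v hv =>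
    PointedCone.hull_le_span ℝ _ (h2 v hv)
  refine ⟨h1, fun v hv => h2 v (hV.mem_coneInterior_iff.1 hv), ?_⟩
  rw [eq_top_iff]
  rintro v -
  obtain ⟨t, ht, hle, -⟩ := hu.2 v
  have hv : v + t • u ∈ C := by simpa [Le] using hle
  -- v = (u + (v + tu)) - (t + 1)u is a difference of order units; the extra u also covers t = 0.
  have hmem := sub_mem (h3 _ (hu.add_mem hv)) (h3 _ (hu.smul (show 0 < t + 1 by linarith)))
  convert hmem using 1
  module
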